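/- Let $h_2>h_1>0$ be constants and let $q_1,q_2:\mathbb{R}\to\mathbb{R}$ be such that, for $i=1,2$, $q_i\in C^1(\mathbb{R})$, $q_i'$ is absolutely continuous on every compact interval, $q_i''\in L^2(\mathbb{R})$, and $\int_{\mathbb{R}}(1+|x|^3)\,|q_i^{(k)}(x)|\,dx<\infty$ for $0\le k\le 2$. In the complex Hilbert space $L^2(\mathbb{R})$ let $D_i u=-u''+(q_i+h_i)u$ with domain $H^2(\mathbb{R})$, and assume that there is $c_2>0$ with $(D_2u,u)\ge c_2\|u\|^2$ for all $u\in\mathrm{dom}(D_2)$. Let $D_2^{1/2}$ be the positive square root of $D_2$ (the positive selfadjoint operator whose square, on its natural domain, is $D_2$), let $D_2^{-1/2}$ be its inverse, and let $P_0$ be the orthogonal projection onto $\ker(D_1)$. Define $$\mathrm{dom}(L)=\{u\in\mathrm{dom}(D_1): D_1u\in\mathrm{dom}(D_2)\},\qquad Lu=D_2D_1u,$$ let $L^*$ be the adjoint of $L$, and define $$\mathrm{dom}(\Lambda)=\mathrm{ran}\big(D_2^{-1/2}(D_1+P_0)^{-1}D_2^{-1/2}\big),\qquad \Lambda f=D_2^{1/2}D_1D_2^{1/2}f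 .$$ For an operator $A$ let $\rho(A)$ be the set of $z\in\mathbb{C}$ such that $A-z$ is a bijection of $\mathrm{dom}(A)$ onto $L^2(\mathbb{R})$ with bounded inverse, let $\sigma(A)=\mathbb{C}\setminus\rho(A)$, and for $z\in\rho(A)$ let $R_A(z)=(A-z)^{-1}$. Then these objects are well defined ($D_2^{1/2}$ exists, $L$ is densely defined, and the expression for $\Lambda f$ makes sense for all $f\in\mathrm{dom}(\Lambda)$), $\Lambda$ is selfadjoint, $\rho(L)=\rho(L^*)=\rho(\Lambda)$, and for every $z\in\rho(L)$ $$R_L(z)=D_2^{1/2}R_\Lambda(z)D_2^{-1/2},\qquad R_\Lambda(z)=D_2^{1/2}R_{L^*}(z)D_2^{-1/2},$$ where both right-hand sides are defined on all of $L^2(\mathbb{R})$. In particular $\sigma(L)=\sigma(L^*)=\sigma(\Lambda)\subset\mathbb{R}$. -/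

import Mathlib

open MeasureTheory TemperedDistribution
open scoped SchwartzMap LineDeriv ENNReal

noncomputable section

namespace SpecOp

/-! ### Unbounded operators -/

section Operators

variable {E F G : Type*} [NormedAddCommGroup E] [InnerProductSpace ℂ E]
  [NormedAddCommGroup F] [InnerProductSpace ℂ F] [NormedAddCommGroup G] [InnerProductSpace ℂ G]

/-- The product `g f` of unbounded operators on its natural domain
`{x ∈ dom f | f x ∈ dom g}`. -/
def prodOp (g : F →ₗ.[ℂ] G) (f : E →ₗ.[ℂ] F) : E →ₗ.[ℂ] G where
  domain :=
    { carrier := {x | ∃ h : x ∈ f.domain, f ⟨x, h⟩ ∈ g.domain}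
      zero_mem' := ⟨f.domain.zero_mem, by
        have : f ⟨0, f.domain.zero_mem⟩ = 0 := f.map_zero
        rw [this]; exact g.domain.zero_mem⟩
      add_mem' := by
        rintro x y ⟨hx, hx'⟩ ⟨hy, hy'⟩
        refine ⟨f.domain.add_mem hx hy, ?_⟩
        have : f ⟨x + y, f.domain.add_mem hx hy⟩ = f ⟨x, hx⟩ + f ⟨y, hy⟩ :=
          f.map_add ⟨x, hx⟩ ⟨y, hy⟩
        rw [this]; exact g.domain.add_mem hx' hy'
      smul_mem' := by
        rintro c x ⟨hx, hx'⟩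
        refine ⟨f.domain.smul_mem c hx, ?_⟩
        have : f ⟨c • x, f.domain.smul_mem c hx⟩ = c • f ⟨x, hx⟩ := f.map_smul c ⟨x, hx⟩
        rw [this]; exact g.domain.smul_mem c hx' }
  toFun :=
    { toFun := fun x => g ⟨f ⟨x.1, x.2.1⟩, x.2.2⟩
      map_add' := by
        rintro ⟨x, hx, hx'⟩ ⟨y, hy, hy'⟩
        rw [← g.map_add]
        congr 1
        exact Subtype.ext (f.map_add ⟨x, hx⟩ ⟨y, hy⟩)
      map_smul' := by
        rintro c ⟨x, hx, hx'⟩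
        rw [RingHom.id_apply, ← g.map_smul]
        congr 1
        exact Subtype.ext (f.map_smul c ⟨x, hx⟩) }

/-- The operator `A - z I`, with the domain of `A`. -/
def shift (A : E →ₗ.[ℂ] E) (z : ℂ) : E →ₗ.[ℂ] E where
  domain := A.domain
  toFun := A.toFun - z • A.domain.subtype

/-- The resolvent set: those `z` for which `A - z I` maps the domain of `A` bijectively onto the
whole space, with bounded inverse. -/
def rho (A : E →ₗ.[ℂ] E) : Set ℂ :=
  {z | Function.Injective (shift A z) ∧ Function.Surjective (shift A z) ∧
    ∃ C : ℝ, ∀ x : (shift A z).domain, ‖(x : E)‖ ≤ C * ‖shift A z x‖}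

/-- The spectrum. -/
def sigma (A : E →ₗ.[ℂ] E) : Set ℂ := (rho A)ᶜ

/-- The resolvent `(A - z I)⁻¹`, an operator whose domain is the range of `A - z I`; it is only
used for `z` in the resolvent set. -/
def resolventOp (A : E →ₗ.[ℂ] E) (z : ℂ) : E →ₗ.[ℂ] E := (shift A z).inverse

/-- The kernel of an unbounded operator, as a subspace of the ambient space. -/
def kerOp (A : E →ₗ.[ℂ] F) : Submodule ℂ E := (LinearMap.ker A.toFun).map A.domain.subtype

/-- The range of an unbounded operator. -/
def ranOp (A : E →ₗ.[ℂ] F) : Submodule ℂ F := LinearMap.range A.toFun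

variable [CompleteSpace E]

/-- The orthogonal projection onto (the closure of) the kernel of `A`, as an everywhere defined
operator.  The kernel of a selfadjoint operator is closed. -/
def kerProj (A : E →ₗ.[ℂ] E) : E →ₗ.[ℂ] E :=
  ((kerOp A).topologicalClosure.starProjection : E →ₗ[ℂ] E).toPMap ⊤

/-- `T` is a positive selfadjoint operator with `T T = A`, including equality of domains. -/
structure IsPosSqrt (T A : E →ₗ.[ℂ] E) : Prop where
  isSelfAdjoint : IsSelfAdjoint T
  nonneg : ∀ x : T.domain, 0 ≤ (inner ℂ (x : E) (T x)).re
  prodOp_self : prodOp T T = A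

open scoped Classical in
/-- The positive square root `A^{1/2}` of a positive selfadjoint operator `A`. -/
def posSqrt (A : E →ₗ.[ℂ] E) : E →ₗ.[ℂ] E :=
  if h : ∃ T, IsPosSqrt T A then h.choose else 0

end Operators

/-! ### The differential operators -/

/-- The complex Hilbert space `L²(ℝ)`. -/
abbrev L2 : Type := Lp ℂ 2 (volume : Measure ℝ)

/-- The graph of the second (distributional) derivative with domain `H²(ℝ)`. -/
def secondDerivGraph : Submodule ℂ (L2 × L2) where
  carrier := {p | MemSobolev 2 2 (p.1 : 𝓢'(ℝ, ℂ)) ∧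
    ∂_{(1 : ℝ)} (∂_{(1 : ℝ)} (p.1 : 𝓢'(ℝ, ℂ))) = (p.2 : 𝓢'(ℝ, ℂ))}
  zero_mem' := by
    have h0 : ((0 : L2) : 𝓢'(ℝ, ℂ)) = 0 :=
      (Lp.toTemperedDistributionCLM ℂ (volume : Measure ℝ) 2).map_zero
    refine ⟨?_, ?_⟩
    · change MemSobolev 2 2 ((0 : L2) : 𝓢'(ℝ, ℂ))
      rw [h0]; exact memSobolev_fun_zero ℝ ℂ 2 2
    · change ∂_{(1 : ℝ)} (∂_{(1 : ℝ)} ((0 : L2) : 𝓢'(ℝ, ℂ))) = ((0 : L2) : 𝓢'(ℝ, ℂ))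
      rw [h0, LineDeriv.lineDerivOp_zero, LineDeriv.lineDerivOp_zero]
  add_mem' := by
    rintro ⟨u, v⟩ ⟨u', v'⟩ ⟨h, k⟩ ⟨h', k'⟩
    have ha (f g : L2) : ((f + g : L2) : 𝓢'(ℝ, ℂ)) = (f : 𝓢'(ℝ, ℂ)) + (g : 𝓢'(ℝ, ℂ)) :=
      (Lp.toTemperedDistributionCLM ℂ (volume : Measure ℝ) 2).map_add f g
    refine ⟨?_, ?_⟩
    · change MemSobolev 2 2 ((u + u' : L2) : 𝓢'(ℝ, ℂ))
      rw [ha]; exact h.add h'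
    · change ∂_{(1 : ℝ)} (∂_{(1 : ℝ)} ((u + u' : L2) : 𝓢'(ℝ, ℂ))) = ((v + v' : L2) : 𝓢'(ℝ, ℂ))
      rw [ha, ha, LineDeriv.lineDerivOp_add, LineDeriv.lineDerivOp_add]
      exact congrArg₂ (· + ·) k k'
  smul_mem' := by
    rintro c ⟨u, v⟩ ⟨h, k⟩
    have hs (f : L2) : ((c • f : L2) : 𝓢'(ℝ, ℂ)) = c • (f : 𝓢'(ℝ, ℂ)) :=
      (Lp.toTemperedDistributionCLM ℂ (volume : Measure ℝ) 2).map_smul c f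
    refine ⟨?_, ?_⟩
    · change MemSobolev 2 2 ((c • u : L2) : 𝓢'(ℝ, ℂ))
      rw [hs]; exact h.smul c
    · change ∂_{(1 : ℝ)} (∂_{(1 : ℝ)} ((c • u : L2) : 𝓢'(ℝ, ℂ))) = ((c • v : L2) : 𝓢'(ℝ, ℂ))
      rw [hs, hs, LineDeriv.lineDerivOp_smul, LineDeriv.lineDerivOp_smul]
      exact congrArg (c • ·) k

/-- `secondDerivGraph` is the graph of an operator. -/
theorem secondDerivGraph_snd {p : L2 × L2} (hp : p ∈ secondDerivGraph) (h : p.1 = 0) :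
    p.2 = 0 := by
  obtain ⟨u, v⟩ := p
  obtain ⟨-, k⟩ := hp
  simp only at h k
  subst h
  have h0 : ((0 : L2) : 𝓢'(ℝ, ℂ)) = 0 :=
    (Lp.toTemperedDistributionCLM ℂ (volume : Measure ℝ) 2).map_zero
  rw [h0, LineDeriv.lineDerivOp_zero, LineDeriv.lineDerivOp_zero] at k
  have hk : v ∈ (Lp.toTemperedDistributionCLM ℂ (volume : Measure ℝ) 2).ker := k.symm
  rw [Lp.ker_toTemperedDistributionCLM_eq_bot] at hk
  exact hk

/-- The operator `u ↦ u''` with domain `H²(ℝ)`. -/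
def secondDeriv : L2 →ₗ.[ℂ] L2 := secondDerivGraph.toLinearPMap

/-- The graph of multiplication by `V`, on the maximal domain `{u ∈ L² | V u ∈ L²}`. -/
def mulGraph (V : ℝ → ℝ) : Submodule ℂ (L2 × L2) where
  carrier := {p | ∀ᵐ x, p.2 x = (V x : ℂ) * p.1 x}
  zero_mem' := by
    change ∀ᵐ x, (0 : L2) x = (V x : ℂ) * (0 : L2) x
    filter_upwards with x
    simp
  add_mem' := by
    rintro ⟨u, v⟩ ⟨u', v'⟩ h h'
    filter_upwards [h, h', Lp.coeFn_add u u', Lp.coeFn_add v v'] with x h1 h2 h3 h4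
    simp only [Prod.mk_add_mk, h3, h4, Pi.add_apply] at *
    rw [h1, h2]; ring
  smul_mem' := by
    rintro c ⟨u, v⟩ h
    filter_upwards [h, Lp.coeFn_smul c u, Lp.coeFn_smul c v] with x h1 h3 h4
    simp only [Prod.smul_mk, h3, h4, Pi.smul_apply, smul_eq_mul] at *
    rw [h1]; ring

/-- `mulGraph V` is the graph of an operator. -/
theorem mulGraph_snd (V : ℝ → ℝ) {p : L2 × L2} (hp : p ∈ mulGraph V) (h : p.1 = 0) :
    p.2 = 0 := by
  obtain ⟨u, v⟩ := p
  simp only at h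
  subst h
  apply Lp.ext
  have hp' : ∀ᵐ x, v x = (V x : ℂ) * (0 : L2) x := hp
  filter_upwards [hp'] with x h1
  simp [h1]

/-- The operator of multiplication by `V` on its maximal domain (all of `L²(ℝ)` when `V` is
bounded and measurable). -/
def mulOp (V : ℝ → ℝ) : L2 →ₗ.[ℂ] L2 := (mulGraph V).toLinearPMap

/-- The operator `-u'' + (q + h) u` with domain `H²(ℝ)` (intersected with the domain of the
multiplication operator, which is all of `L²(ℝ)` for bounded continuous `q`). -/
def schrodinger (h : ℝ) (q : ℝ → ℝ) : L2 →ₗ.[ℂ] L2 :=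
  -secondDeriv + mulOp (fun x => q x + h)

/-- The assumptions on the real functions `q`. -/
structure IsAdmissible (q : ℝ → ℝ) : Prop where
  contDiff : ContDiff ℝ 1 q
  deriv_ac : ∀ a b : ℝ, AbsolutelyContinuousOnInterval (deriv q) a b
  deriv2_memLp : MemLp (iteratedDeriv 2 q) 2 (volume : Measure ℝ)
  integrable : ∀ k ≤ 2, Integrable (fun x : ℝ => (1 + |x| ^ 3) * |iteratedDeriv k q x|)

/-- The operator `L = D₂ D₁` with domain `{u ∈ dom D₁ | D₁ u ∈ dom D₂}`. -/
def opL (D₁ D₂ : L2 →ₗ.[ℂ] L2) : L2 →ₗ.[ℂ] L2 := prodOp D₂ D₁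

/-- The subspace `ran (D₂^{-1/2} (D₁ + P₀)⁻¹ D₂^{-1/2})`, where `P₀` is the orthogonal projection
onto the kernel of `D₁`. -/
def domLambda (D₁ D₂ : L2 →ₗ.[ℂ] L2) : Submodule ℂ L2 :=
  ranOp (prodOp (posSqrt D₂).inverse (prodOp (D₁ + kerProj D₁).inverse (posSqrt D₂).inverse))

/-- The operator `Λ = D₂^{1/2} D₁ D₂^{1/2}` with domain `domLambda D₁ D₂`. -/
def opLambda (D₁ D₂ : L2 →ₗ.[ℂ] L2) : L2 →ₗ.[ℂ] L2 :=
  (prodOp (posSqrt D₂) (prodOp D₁ (posSqrt D₂))).domRestrict (domLambda D₁ D₂)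

end SpecOp

end

open SpecOp

/-!
Write `R = D₂⁻¹`, `T = D₂^{1/2}` and `J = T⁻¹`; these inverses are bounded because `D₂` is coercive,
and `J² = R`. As `q₁` and `q₂` are bounded, `D₁ = D₂ + B` with `B` bounded and selfadjoint. From
`⟪u, D₂ u⟫ + β² ⟪u, R u⟫ ≥ 2 β ‖u‖²` it follows that, for `t = β²` large, the selfadjoint operator
`D₁ + t R` is coercive and so has a bounded selfadjoint inverse `G`
(`exists_bounded_inverse_add_smul`). Factoring out `D₂`, or `T` on both sides, gives
`L + t = D₂ (D₁ + t R) = (G J J)⁻¹`, hence `L* + t = (J J G)⁻¹`, and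
`Λ + t = T (D₁ + t R) T = (J G J)⁻¹` (`isShiftedInverse_prodOp`, `IsShiftedInverse.adjoint`,
`isShiftedInverse_prodOp_prodOp`).

The three bounded operators differ only by the order of their factors. If `A + t = K⁻¹`, then `z`
lies in the resolvent set of `A` exactly when `1 - (z + t) K` is invertible
(`IsShiftedInverse.mem_rho_iff`), and `1 - a b` is invertible exactly when `1 - b a` is. This yields
the equality of the resolvent sets (`rho_eq_of_swap`) and, keeping track of the inverses, the
relations between the resolvents (`resolventOp_eq_of_swap`). Finally `J G J` is selfadjoint, so `Λ`
is selfadjoint and its spectrum is real.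

The range in the definition of `dom Λ` is the natural domain of the product `T D₁ T`
(`domLambda_eq`); only the injectivity of `D₁ + P₀` matters here. Selfadjointness of `D₁` and `D₂`
is that of `-u''` on `H²(ℝ)` (`isSelfAdjoint_neg_secondDeriv`), whose shifted inverse is a Fourier
multiplier, together with stability under bounded perturbations.

Unbounded operators are compared through their graphs throughout.
-/

namespace SpecOp

/-! ### Graphs of unbounded operators -/

section Graphs

variable {E F G : Type*} [NormedAddCommGroup E] [InnerProductSpace ℂ E]
  [NormedAddCommGroup F] [InnerProductSpace ℂ F] [NormedAddCommGroup G] [InnerProductSpace ℂ G]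

theorem linearPMap_ext_graph {A B : E →ₗ.[ℂ] F}
    (h : ∀ x y, (x, y) ∈ A.graph ↔ (x, y) ∈ B.graph) : A = B :=
  LinearPMap.eq_of_eq_graph (Submodule.ext fun p => h p.1 p.2)

theorem mem_graph_iff_exists_mem {A : E →ₗ.[ℂ] F} {x : E} {y : F} :
    (x, y) ∈ A.graph ↔ ∃ h : x ∈ A.domain, A ⟨x, h⟩ = y := by
  rw [LinearPMap.mem_graph_iff]
  constructor
  · rintro ⟨⟨a, ha⟩, rfl, h⟩
    exact ⟨ha, h⟩
  · rintro ⟨h, rfl⟩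
    exact ⟨⟨x, h⟩, rfl, rfl⟩

theorem mem_domain_iff_exists_graph {A : E →ₗ.[ℂ] F} {x : E} :
    x ∈ A.domain ↔ ∃ y, (x, y) ∈ A.graph := by
  simp only [mem_graph_iff_exists_mem]
  exact ⟨fun h => ⟨_, h, rfl⟩, fun ⟨_, h, _⟩ => h⟩

theorem graph_unique {A : E →ₗ.[ℂ] F} {x : E} {y z : F} (hy : (x, y) ∈ A.graph)
    (hz : (x, z) ∈ A.graph) : y = z :=
  A.mem_graph_snd_inj hy hz rfl

theorem mem_graph_prodOp {g : F →ₗ.[ℂ] G} {f : E →ₗ.[ℂ] F} {x : E} {y : G} :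
    (x, y) ∈ (prodOp g f).graph ↔ ∃ w, (x, w) ∈ f.graph ∧ (w, y) ∈ g.graph := by
  simp only [mem_graph_iff_exists_mem]
  constructor
  · rintro ⟨⟨hx, hx'⟩, h⟩
    exact ⟨_, ⟨hx, rfl⟩, hx', h⟩
  · rintro ⟨w, ⟨hx, rfl⟩, hw, h⟩
    exact ⟨⟨hx, hw⟩, h⟩

theorem mem_graph_shift {A : E →ₗ.[ℂ] E} {z : ℂ} {x y : E} :
    (x, y) ∈ (shift A z).graph ↔ (x, y + z • x) ∈ A.graph := by
  simp only [mem_graph_iff_exists_mem]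
  constructor
  · rintro ⟨h, rfl⟩
    refine ⟨h, ?_⟩
    change A ⟨x, h⟩ = (A ⟨x, h⟩ - z • x) + z • x
    simp
  · rintro ⟨h, h'⟩
    refine ⟨h, ?_⟩
    change A ⟨x, h⟩ - z • x = y
    rw [h']; simp

theorem mem_graph_toPMap_top {K : E →ₗ[ℂ] F} {x : E} {y : F} :
    (x, y) ∈ (K.toPMap ⊤).graph ↔ y = K x := by
  rw [mem_graph_iff_exists_mem]
  exact ⟨fun ⟨_, h⟩ => h.symm, fun h => ⟨trivial, h.symm⟩⟩

theorem mem_graph_add_toPMap_top {A : E →ₗ.[ℂ] F} {B : E →ₗ[ℂ] F} {x : E} {y : F} :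
    (x, y) ∈ (A + B.toPMap ⊤).graph ↔ (x, y - B x) ∈ A.graph := by
  simp only [mem_graph_iff_exists_mem]
  constructor
  · rintro ⟨h, rfl⟩
    refine ⟨h.1, ?_⟩
    change A ⟨x, h.1⟩ = (A ⟨x, h.1⟩ + B x) - B x
    simp
  · rintro ⟨h, h'⟩
    refine ⟨⟨h, trivial⟩, ?_⟩
    change A ⟨x, h⟩ + B x = y
    rw [h']; simp

theorem mem_graph_neg {A : E →ₗ.[ℂ] F} {x : E} {y : F} :
    (x, y) ∈ (-A).graph ↔ (x, -y) ∈ A.graph := by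
  simp only [mem_graph_iff_exists_mem]
  constructor
  · rintro ⟨h, rfl⟩
    refine ⟨h, ?_⟩
    change A ⟨x, h⟩ = - -A ⟨x, h⟩
    simp
  · rintro ⟨h, h'⟩
    refine ⟨h, ?_⟩
    change -A ⟨x, h⟩ = y
    rw [h']; simp

theorem ker_toFun_eq_bot {A : E →ₗ.[ℂ] F} (h : ∀ x, (x, (0 : F)) ∈ A.graph → x = 0) :
    LinearMap.ker A.toFun = ⊥ := by
  rw [LinearMap.ker_eq_bot']
  intro x hx
  exact Subtype.ext (h x (mem_graph_iff_exists_mem.2 ⟨x.2, hx⟩))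

theorem mem_graph_inverse {A : E →ₗ.[ℂ] F} (h : ∀ x, (x, (0 : F)) ∈ A.graph → x = 0)
    {x : E} {y : F} : (y, x) ∈ A.inverse.graph ↔ (x, y) ∈ A.graph := by
  rw [LinearPMap.inverse_graph (ker_toFun_eq_bot h)]
  simp

theorem mem_ranOp {A : E →ₗ.[ℂ] F} {y : F} : y ∈ ranOp A ↔ ∃ x, (x, y) ∈ A.graph := by
  simp only [mem_graph_iff_exists_mem]
  constructor
  · rintro ⟨x, hx⟩
    exact ⟨x, x.2, hx⟩
  · rintro ⟨x, h, hx⟩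
    exact ⟨⟨x, h⟩, hx⟩

theorem mem_kerOp {A : E →ₗ.[ℂ] F} {x : E} : x ∈ kerOp A ↔ (x, (0 : F)) ∈ A.graph := by
  simp only [mem_graph_iff_exists_mem]
  constructor
  · rintro ⟨⟨x, h⟩, hx, rfl⟩
    exact ⟨h, hx⟩
  · rintro ⟨h, hx⟩
    exact ⟨⟨x, h⟩, hx, rfl⟩

variable [CompleteSpace E]

theorem mem_graph_adjoint {A : E →ₗ.[ℂ] E} (hA : Dense (A.domain : Set E)) {y w : E} :
    (y, w) ∈ A.adjoint.graph ↔ ∀ a b, (a, b) ∈ A.graph → inner ℂ y b = inner ℂ w a := by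
  rw [LinearPMap.adjoint_graph_eq_graph_adjoint hA, Submodule.mem_adjoint_iff]
  refine forall₃_congr fun a b _ => ?_
  rw [sub_eq_zero, ← inner_conj_symm b y, ← inner_conj_symm a w]
  exact (starRingEnd ℂ).injective.eq_iff

theorem mem_graph_iff_of_isSelfAdjoint {A : E →ₗ.[ℂ] E} (hA : IsSelfAdjoint A) {y w : E} :
    (y, w) ∈ A.graph ↔ ∀ a b, (a, b) ∈ A.graph → inner ℂ y b = inner ℂ w a := by
  rw [← mem_graph_adjoint hA.dense_domain, LinearPMap.isSelfAdjoint_def.1 hA]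

/-- Selfadjointness is stable under bounded selfadjoint perturbations. -/
theorem isSelfAdjoint_add_toPMap_top {A : E →ₗ.[ℂ] E} (hA : IsSelfAdjoint A) {B : E →L[ℂ] E}
    (hB : IsSelfAdjoint B) : IsSelfAdjoint (A + (B : E →ₗ[ℂ] E).toPMap ⊤) := by
  have hd : Dense ((A + (B : E →ₗ[ℂ] E).toPMap ⊤).domain : Set E) := by
    have : (A + (B : E →ₗ[ℂ] E).toPMap ⊤).domain = A.domain := by
      rw [LinearPMap.add_domain]; exact inf_top_eq _
    rw [this]; exact hA.dense_domain
  refine LinearPMap.isSelfAdjoint_def.2 (linearPMap_ext_graph fun y w => ?_)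
  rw [mem_graph_adjoint hd, mem_graph_add_toPMap_top, mem_graph_iff_of_isSelfAdjoint hA]
  have hBs : ∀ a b, inner ℂ (B a) b = inner ℂ a (B b) := hB.isSymmetric
  constructor
  · intro h a b hab
    have := h a (b + B a) (mem_graph_add_toPMap_top.2 (by simpa using hab))
    rw [inner_add_right] at this
    rw [inner_sub_left, ← this, ContinuousLinearMap.coe_coe, hBs]
    ring
  · intro h a b hab
    have := h a _ (mem_graph_add_toPMap_top.1 hab)
    rw [inner_sub_left, inner_sub_right, ContinuousLinearMap.coe_coe, hBs] at this
    linear_combination this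

/-- A bijective selfadjoint operator has a bounded selfadjoint inverse, by the
Hellinger–Toeplitz theorem. -/
theorem exists_bounded_inverse {A : E →ₗ.[ℂ] E} (hA : IsSelfAdjoint A)
    (hinj : ∀ x, (x, (0 : E)) ∈ A.graph → x = 0) (hsurj : ∀ y, ∃ x, (x, y) ∈ A.graph) :
    ∃ K : E →L[ℂ] E, IsSelfAdjoint K ∧ ∀ x y, (x, y) ∈ A.graph ↔ x = K y := by
  have hu : ∀ {x x' y}, (x, y) ∈ A.graph → (x', y) ∈ A.graph → x = x' := by
    intro x x' y h h'
    refine sub_eq_zero.1 (hinj _ ?_)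
    simpa using A.graph.sub_mem h h'
  choose k hk using hsurj
  let K : E →ₗ[ℂ] E :=
    { toFun := k
      map_add' := fun x y => hu (hk _) (A.graph.add_mem (hk x) (hk y))
      map_smul' := fun c x => hu (hk _) (A.graph.smul_mem c (hk x)) }
  have hK : K.IsSymmetric := fun x y =>
    (((mem_graph_iff_of_isSelfAdjoint hA).1 (hk x)) _ _ (hk y))
  refine ⟨⟨K, hK.continuous⟩, ?_, fun x y => ⟨fun h => hu h (hk y), ?_⟩⟩
  · rw [ContinuousLinearMap.isSelfAdjoint_iff_isSymmetric]; exact hK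
  · rintro rfl; exact hk y

/-- A selfadjoint operator bounded below by a positive constant has a bounded selfadjoint
inverse. -/
theorem exists_bounded_inverse_of_coercive {A : E →ₗ.[ℂ] E} (hA : IsSelfAdjoint A)
    {δ : ℝ} (hδ : 0 < δ) (hc : ∀ x y, (x, y) ∈ A.graph → δ * ‖x‖ ^ 2 ≤ (inner ℂ x y).re) :
    ∃ K : E →L[ℂ] E, IsSelfAdjoint K ∧ ∀ x y, (x, y) ∈ A.graph ↔ x = K y := by
  have hle : ∀ x y, (x, y) ∈ A.graph → δ * ‖x‖ ≤ ‖y‖ := by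
    intro x y h
    have h1 : δ * ‖x‖ ^ 2 ≤ ‖x‖ * ‖y‖ :=
      (hc x y h).trans ((Complex.re_le_norm _).trans (norm_inner_le_norm x y))
    rcases (norm_nonneg x).eq_or_lt with h0 | h0
    · rw [← h0]; simp
    · refine le_of_mul_le_mul_left ?_ h0
      linarith
  have hinj : ∀ x, (x, (0 : E)) ∈ A.graph → x = 0 := by
    intro x h
    have := hle x 0 h
    rw [norm_zero] at this
    have h0 := norm_nonneg x
    have : ‖x‖ ≤ 0 := by nlinarith
    exact norm_le_zero_iff.1 this
  refine exists_bounded_inverse hA hinj ?_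
  -- The range is closed, being the image of the closed graph under a map bounded below.
  have hcl : IsClosed (ranOp A : Set E) := by
    have : CompleteSpace A.graph := by
      have hgc : IsClosed (A.graph : Set (E × E)) := IsSelfAdjoint.isClosed hA
      exact hgc.completeSpace_coe
    have hanti : AntilipschitzWith (max δ⁻¹ 1).toNNReal
        (fun p : A.graph => (p : E × E).2) := by
      refine AntilipschitzWith.of_le_mul_dist fun p q => ?_
      have hm := A.graph.sub_mem p.2 q.2
      have h1 := hle _ _ hm
      rw [Real.coe_toNNReal _ (le_max_of_le_right zero_le_one), Subtype.dist_eq, dist_eq_norm,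
        dist_eq_norm, Prod.norm_def]
      have h2 : ‖(p : E × E).1 - (q : E × E).1‖ ≤ δ⁻¹ * ‖(p : E × E).2 - (q : E × E).2‖ := by
        rw [inv_mul_eq_div, le_div_iff₀ hδ, mul_comm]; exact h1
      refine max_le (h2.trans ?_) ?_
      · exact mul_le_mul_of_nonneg_right (le_max_left _ _) (norm_nonneg _)
      · exact le_mul_of_one_le_left (norm_nonneg _) (le_max_right _ _)
    have huc : UniformContinuous (fun p : A.graph => (p : E × E).2) :=
      uniformContinuous_snd.comp uniformContinuous_subtype_val
    have hr := hanti.isClosed_range huc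
    convert hr using 1
    ext y
    simp only [SetLike.mem_coe, mem_ranOp, Set.mem_range, Subtype.exists, Prod.exists,
      exists_prop, exists_eq_right]
  -- The orthogonal complement of the range is the kernel of the adjoint, which is trivial.
  have horth : (ranOp A)ᗮ = ⊥ := by
    rw [eq_bot_iff]
    intro w hw
    refine hinj w ((mem_graph_iff_of_isSelfAdjoint hA).2 fun a b hab => ?_)
    rw [inner_zero_left]
    exact Submodule.inner_left_of_mem_orthogonal (mem_ranOp.2 ⟨a, hab⟩) hw
  have htop : ranOp A = ⊤ := by
    rw [← Submodule.topologicalClosure_eq_top_iff, hcl.submodule_topologicalClosure_eq] at horth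
    exact horth
  intro y
  exact mem_ranOp.1 (htop ▸ Submodule.mem_top)

end Graphs

/-! ### Operators with a bounded inverse after a shift -/

section ShiftedInverse

variable {E : Type*} [NormedAddCommGroup E] [InnerProductSpace ℂ E]

/-- `A + c` is the inverse of the everywhere defined bounded operator `K`; in particular `K` is
injective and its range is the domain of `A`. The condition is stated on the graph of `A`. -/
def IsShiftedInverse (A : E →ₗ.[ℂ] E) (c : ℂ) (K : E →L[ℂ] E) : Prop :=
  ∀ x y, (x, y) ∈ A.graph ↔ x = K (y + c • x)

variable {A : E →ₗ.[ℂ] E} {c : ℂ} {K : E →L[ℂ] E}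

theorem isShiftedInverse_zero : IsShiftedInverse A 0 K ↔ ∀ x y, (x, y) ∈ A.graph ↔ x = K y := by
  simp [IsShiftedInverse]

theorem IsShiftedInverse.mem_graph (h : IsShiftedInverse A c K) (v : E) :
    (K v, v - c • K v) ∈ A.graph := by
  rw [h]; simp

theorem IsShiftedInverse.eq_zero (h : IsShiftedInverse A c K) {v : E} (hv : K v = 0) : v = 0 := by
  have := h.mem_graph v
  rw [hv, smul_zero, sub_zero] at this
  exact graph_unique this A.graph.zero_mem

theorem IsShiftedInverse.injective (h : IsShiftedInverse A c K) : Function.Injective K :=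
  (injective_iff_map_eq_zero K).2 fun _ hv => h.eq_zero hv

theorem IsShiftedInverse.mem_graph_inverse (h : IsShiftedInverse A 0 K) {x y : E} :
    (x, y) ∈ A.inverse.graph ↔ y = K x := by
  rw [SpecOp.mem_graph_inverse, isShiftedInverse_zero.1 h]
  intro x hx
  rw [isShiftedInverse_zero.1 h] at hx
  simpa using hx

/-- With `A + c = K⁻¹` and `x = K w` one has `(A - z) x = (1 - (z + c) K) w`. -/
theorem IsShiftedInverse.shift_graph (h : IsShiftedInverse A c K) {z : ℂ} {x y : E} :
    (x, y) ∈ (shift A z).graph ↔ ∃ w, x = K w ∧ (1 - (z + c) • K) w = y := by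
  rw [mem_graph_shift, h]
  constructor
  · intro hx
    refine ⟨_, hx, ?_⟩
    rw [sub_apply, smul_apply, ← hx,
      one_apply_eq_self, add_smul]
    abel
  · rintro ⟨w, rfl, rfl⟩
    congr 1
    rw [sub_apply, smul_apply, one_apply_eq_self, add_smul]
    abel

theorem IsShiftedInverse.mem_rho_iff [CompleteSpace E] (h : IsShiftedInverse A c K) {z : ℂ} :
    z ∈ rho A ↔ IsUnit (1 - (z + c) • K) := by
  constructor
  · rintro ⟨hi, hs, -⟩
    rw [ContinuousLinearMap.isUnit_iff_bijective]
    constructor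
    · refine (injective_iff_map_eq_zero _).2 fun w hw => ?_
      have hg : (K w, (0 : E)) ∈ (shift A z).graph := h.shift_graph.2 ⟨w, rfl, hw⟩
      obtain ⟨hd, h0⟩ := mem_graph_iff_exists_mem.1 hg
      have : (⟨K w, hd⟩ : (shift A z).domain) = 0 := hi (h0.trans (LinearPMap.map_zero _).symm)
      exact h.eq_zero (congrArg Subtype.val this)
    · intro y
      obtain ⟨x, hx⟩ := hs y
      obtain ⟨w, -, hw⟩ := h.shift_graph.1 (mem_graph_iff_exists_mem.2 ⟨x.2, hx⟩)
      exact ⟨w, hw⟩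
  · rintro ⟨u, hu⟩
    have huinv : ∀ w, (↑u⁻¹ : E →L[ℂ] E) ((1 - (z + c) • K) w) = w := fun w => by
      rw [← hu, ← mul_apply_eq_comp, Units.inv_mul, one_apply_eq_self]
    have hinvu : ∀ w, (1 - (z + c) • K) ((↑u⁻¹ : E →L[ℂ] E) w) = w := fun w => by
      rw [← hu, ← mul_apply_eq_comp, Units.mul_inv, one_apply_eq_self]
    have hsol : ∀ x : (shift A z).domain,
        (x : E) = (K * (↑u⁻¹ : E →L[ℂ] E)) (shift A z x) := fun x => by
      obtain ⟨w, hx, hw⟩ := h.shift_graph.1 (mem_graph_iff_exists_mem.2 ⟨x.2, rfl⟩)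
      have hw' : (1 - (z + c) • K) w = shift A z x := hw
      rw [← hw', mul_apply_eq_comp, huinv, hx]
    refine ⟨?_, ?_, ‖K * (↑u⁻¹ : E →L[ℂ] E)‖, fun x => ?_⟩
    · intro x y hxy
      apply Subtype.ext
      rw [hsol x, hsol y, hxy]
    · intro y
      obtain ⟨hd, hy⟩ := mem_graph_iff_exists_mem.1 (h.shift_graph.2 ⟨_, rfl, hinvu y⟩)
      exact ⟨_, hy⟩
    · conv_lhs => rw [hsol x]
      exact ContinuousLinearMap.le_opNorm _ _

theorem IsShiftedInverse.mem_graph_resolventOp (h : IsShiftedInverse A c K) {z : ℂ}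
    {U : E →L[ℂ] E} (h1 : U * (1 - (z + c) • K) = 1) (h2 : (1 - (z + c) • K) * U = 1) {x y : E} :
    (x, y) ∈ (resolventOp A z).graph ↔ y = K (U x) := by
  have h1' : ∀ w, U ((1 - (z + c) • K) w) = w := fun w => DFunLike.congr_fun h1 w
  have h2' : ∀ w, (1 - (z + c) • K) (U w) = w := fun w => DFunLike.congr_fun h2 w
  rw [resolventOp, SpecOp.mem_graph_inverse, h.shift_graph]
  · constructor
    · rintro ⟨w, rfl, rfl⟩
      rw [h1']
    · rintro rfl
      exact ⟨U x, rfl, h2' x⟩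
  · intro x hx
    obtain ⟨w, rfl, hw⟩ := h.shift_graph.1 hx
    have := h1' w
    rw [hw, map_zero] at this
    rw [← this, map_zero]

variable [CompleteSpace E]

theorem IsShiftedInverse.dense_domain (h : IsShiftedInverse A c K)
    (hK : Function.Injective (ContinuousLinearMap.adjoint K)) : Dense (A.domain : Set E) := by
  have hsub : (LinearMap.range (K : E →ₗ[ℂ] E)) ≤ A.domain := by
    rintro _ ⟨v, rfl⟩
    exact mem_domain_iff_exists_graph.2 ⟨_, h.mem_graph v⟩
  rw [Submodule.dense_iff_topologicalClosure_eq_top, Submodule.topologicalClosure_eq_top_iff,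
    eq_bot_iff]
  intro w hw
  refine hK ?_
  rw [map_zero]
  refine ext_inner_right ℂ fun v => ?_
  rw [inner_zero_left, ContinuousLinearMap.adjoint_inner_left]
  exact Submodule.inner_left_of_mem_orthogonal (hsub ⟨v, rfl⟩) hw

/-- The adjoint of the inverse is the inverse of the adjoint. -/
theorem IsShiftedInverse.adjoint (h : IsShiftedInverse A c K)
    (hK : Function.Injective (ContinuousLinearMap.adjoint K)) :
    IsShiftedInverse A.adjoint (starRingEnd ℂ c) (ContinuousLinearMap.adjoint K) := by
  intro y w
  rw [mem_graph_adjoint (h.dense_domain hK)]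
  have key : ∀ v, inner ℂ y (v - c • K v) = inner ℂ w (K v) ↔
      inner ℂ y v = inner ℂ (ContinuousLinearMap.adjoint K (w + starRingEnd ℂ c • y)) v := by
    intro v
    rw [ContinuousLinearMap.adjoint_inner_left, inner_add_left, inner_smul_left, inner_sub_right,
      inner_smul_right, Complex.conj_conj, sub_eq_iff_eq_add]
  constructor
  · intro hy
    exact ext_inner_right ℂ fun v => (key v).1 (hy _ _ (h.mem_graph v))
  · intro hy a b hab
    have ha := (h a b).1 hab
    have hv := (key (b + c • a)).2 (by rw [← hy])
    rw [← ha] at hv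
    simpa using hv

theorem IsShiftedInverse.isSelfAdjoint {t : ℝ} (h : IsShiftedInverse A (t : ℂ) K)
    (hK : IsSelfAdjoint K) : IsSelfAdjoint A := by
  have hK' : ContinuousLinearMap.adjoint K = K := hK
  have := h.adjoint (by rw [hK']; exact h.injective)
  rw [hK', Complex.conj_ofReal] at this
  refine LinearPMap.isSelfAdjoint_def.2 (linearPMap_ext_graph fun x y => ?_)
  rw [this, h]

end ShiftedInverse

/-! ### Positive square roots -/

section SquareRoot

variable {E : Type*} [NormedAddCommGroup E] [InnerProductSpace ℂ E] [CompleteSpace E]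

/-- The square root is the inverse of the square root of the bounded inverse. -/
theorem exists_isPosSqrt {A : E →ₗ.[ℂ] E} {R : E →L[ℂ] E} (hR : IsSelfAdjoint R)
    (hA : IsShiftedInverse A 0 R) (hpos : ∀ x y, (x, y) ∈ A.graph → 0 ≤ (inner ℂ x y).re) :
    ∃ T, IsPosSqrt T A := by
  have hA' := isShiftedInverse_zero.1 hA
  have hRpos : 0 ≤ R := by
    rw [ContinuousLinearMap.nonneg_iff_isPositive, ContinuousLinearMap.isPositive_def']
    exact ⟨hR, fun y => hpos _ _ ((hA' _ _).2 rfl)⟩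
  obtain ⟨J, hJ0, hJJ⟩ : ∃ J : E →L[ℂ] E, 0 ≤ J ∧ J * J = R :=
    ⟨CFC.sqrt R, CFC.sqrt_nonneg R, CFC.sqrt_mul_sqrt_self R⟩
  have hJpos := (ContinuousLinearMap.nonneg_iff_isPositive J).1 hJ0
  have hJs : IsSelfAdjoint J := hJpos.isSelfAdjoint
  have hJJ' : ∀ x, J (J x) = R x := fun x => DFunLike.congr_fun hJJ x
  have hT : IsShiftedInverse ((J : E →ₗ[ℂ] E).toPMap ⊤).inverse 0 J := by
    refine isShiftedInverse_zero.2 fun x y => ?_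
    rw [mem_graph_inverse, mem_graph_toPMap_top]
    · rfl
    · intro v hv
      have hv' : J v = 0 := (mem_graph_toPMap_top.1 hv).symm
      exact hA.eq_zero (by rw [← hJJ', hv', map_zero])
  have hT' := isShiftedInverse_zero.1 hT
  refine ⟨_, IsShiftedInverse.isSelfAdjoint (t := 0) (by simpa using hT) hJs, fun x => ?_, ?_⟩
  · have hx := (hT' _ _).1 (mem_graph_iff_exists_mem.2 ⟨x.2, rfl⟩)
    conv_rhs => rw [hx]
    exact hJpos.re_inner_nonneg_left _
  · refine linearPMap_ext_graph fun x y => ?_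
    simp only [mem_graph_prodOp, hT', hA', ← hJJ']
    exact ⟨fun ⟨w, h1, h2⟩ => h2 ▸ h1, fun h => ⟨_, h, rfl⟩⟩

theorem IsPosSqrt.exists_bounded_inverse {T A : E →ₗ.[ℂ] E} (hT : IsPosSqrt T A)
    {R : E →L[ℂ] E} (hA : IsShiftedInverse A 0 R) :
    ∃ J : E →L[ℂ] E, IsSelfAdjoint J ∧ IsShiftedInverse T 0 J ∧ ∀ x, J (J x) = R x := by
  have hA' := isShiftedInverse_zero.1 hA
  have hTT : ∀ x y, (x, y) ∈ A.graph ↔ ∃ w, (x, w) ∈ T.graph ∧ (w, y) ∈ T.graph := fun x y => by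
    rw [← hT.prodOp_self, mem_graph_prodOp]
  obtain ⟨J, hJ, hJT⟩ := SpecOp.exists_bounded_inverse hT.isSelfAdjoint (A := T)
    (fun x hx => by
      have := (hA' x 0).1 ((hTT x 0).2 ⟨0, hx, T.graph.zero_mem⟩)
      simpa using this)
    (fun y => by
      obtain ⟨w, -, hw⟩ := (hTT (R y) y).1 ((hA' _ _).2 rfl)
      exact ⟨w, hw⟩)
  refine ⟨J, hJ, isShiftedInverse_zero.2 hJT, fun x => ?_⟩
  exact (hA' _ _).1 ((hTT _ _).2 ⟨J x, (hJT _ _).2 rfl, (hJT _ _).2 rfl⟩)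

theorem isPosSqrt_posSqrt {A : E →ₗ.[ℂ] E} (h : ∃ T, IsPosSqrt T A) :
    IsPosSqrt (posSqrt A) A := by
  rw [posSqrt, dif_pos h]
  exact h.choose_spec

/-- The operator `D + B + λ D⁻¹` has a bounded inverse for a suitable `λ ≥ 0`: since
`⟪u, D u⟫ + β² ⟪u, D⁻¹ u⟫ ≥ 2 β ‖u‖²`, it is coercive as soon as `2 β > ‖B‖`. -/
theorem exists_bounded_inverse_add_smul {D : E →ₗ.[ℂ] E} (hD : IsSelfAdjoint D)
    {B J R : E →L[ℂ] E} (hB : IsSelfAdjoint B) (hJ : IsSelfAdjoint J) (hR : IsSelfAdjoint R)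
    (hJJ : ∀ x, J (J x) = R x) (hDR : IsShiftedInverse D 0 R) :
    ∃ (t : ℝ) (G : E →L[ℂ] E), IsSelfAdjoint G ∧
      IsShiftedInverse (D + (B : E →ₗ[ℂ] E).toPMap ⊤ + ((t : ℂ) • R : E →L[ℂ] E).toPMap ⊤)
        0 G := by
  set β : ℝ := (‖B‖ + 1) / 2 with hβ
  have hβ0 : 0 < β := by positivity
  have hs : IsSelfAdjoint (D + (B : E →ₗ[ℂ] E).toPMap ⊤ +
      (((β ^ 2 : ℝ) : ℂ) • R : E →L[ℂ] E).toPMap ⊤) := by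
    refine isSelfAdjoint_add_toPMap_top (isSelfAdjoint_add_toPMap_top hD hB) ?_
    exact IsSelfAdjoint.smul (Complex.conj_ofReal _) hR
  obtain ⟨G, hG, hGg⟩ := exists_bounded_inverse_of_coercive hs one_pos (by
    intro x y hxy
    rw [mem_graph_add_toPMap_top, mem_graph_add_toPMap_top] at hxy
    obtain ⟨v, rfl⟩ : ∃ v, y = v + B x + ((β ^ 2 : ℝ) : ℂ) • R x := ⟨y - B x -
      ((β ^ 2 : ℝ) : ℂ) • R x, by abel⟩
    have hx : x = R v := by
      refine (isShiftedInverse_zero.1 hDR _ _).1 ?_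
      convert hxy using 2
      change v = v + B x + ((β ^ 2 : ℝ) : ℂ) • R x - ((β ^ 2 : ℝ) : ℂ) • R x - B x
      abel
    have hJs : ∀ a b, inner ℂ (J a) b = inner ℂ a (J b) := hJ.isSymmetric
    set w := J v with hw
    have hxw : x = J w := by rw [hx, ← hJJ]
    have e1 : (inner ℂ x v).re = ‖w‖ ^ 2 := by
      rw [hxw, hJs, ← hw]; exact inner_self_eq_norm_sq (𝕜 := ℂ) w
    have e2 : (inner ℂ x (R x)).re = ‖J x‖ ^ 2 := by
      rw [← hJJ, ← hJs]; exact inner_self_eq_norm_sq (𝕜 := ℂ) (J x)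
    have e3 : ‖x‖ ^ 2 ≤ ‖w‖ * ‖J x‖ := by
      have h1 : (inner ℂ x x).re = ‖x‖ ^ 2 := inner_self_eq_norm_sq (𝕜 := ℂ) x
      have h2 : inner ℂ x x = inner ℂ w (J x) := by
        conv_lhs => rw [hxw, hJs, ← hxw]
      rw [← h1, h2]
      exact (Complex.re_le_norm _).trans (norm_inner_le_norm _ _)
    have e4 : -(‖B‖ * ‖x‖ ^ 2) ≤ (inner ℂ x (B x)).re := by
      have h1 : ‖inner ℂ x (B x)‖ ≤ ‖x‖ * (‖B‖ * ‖x‖) :=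
        (norm_inner_le_norm _ _).trans
          (mul_le_mul_of_nonneg_left (B.le_opNorm x) (norm_nonneg x))
      have h2 := (abs_le.1 ((Complex.abs_re_le_norm _).trans h1)).1
      linarith
    rw [inner_add_right, inner_add_right, inner_smul_right, Complex.add_re, Complex.add_re,
      Complex.re_ofReal_mul, e1, e2]
    have e5 : 2 * β = ‖B‖ + 1 := by rw [hβ]; ring
    nlinarith [sq_nonneg (‖w‖ - β * ‖J x‖), mul_le_mul_of_nonneg_left e3 hβ0.le])
  exact ⟨β ^ 2, G, hG, isShiftedInverse_zero.2 hGg⟩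

end SquareRoot

/-! ### Inverses that differ by the order of two factors -/

section Swap

/-- If `u` inverts `1 - a b`, then `1 + b u a` inverts `1 - b a`. -/
theorem isUnit_one_sub_mul_swap {M : Type*} [Ring M] {a b : M} (h : IsUnit (1 - a * b)) :
    IsUnit (1 - b * a) := by
  obtain ⟨u, hu⟩ := h
  have h1 : (1 - a * b) * (↑u⁻¹ : M) = 1 := by rw [← hu, Units.mul_inv]
  have h2 : (↑u⁻¹ : M) * (1 - a * b) = 1 := by rw [← hu, Units.inv_mul]
  refine ⟨⟨1 - b * a, 1 + b * ↑u⁻¹ * a, ?_, ?_⟩, rfl⟩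
  · calc (1 - b * a) * (1 + b * ↑u⁻¹ * a)
        = 1 - b * a + b * ((1 - a * b) * ↑u⁻¹) * a := by noncomm_ring
      _ = 1 := by rw [h1]; noncomm_ring
  · calc (1 + b * ↑u⁻¹ * a) * (1 - b * a)
        = 1 - b * a + b * (↑u⁻¹ * (1 - a * b)) * a := by noncomm_ring
      _ = 1 := by rw [h2]; noncomm_ring

variable {E : Type*} [NormedAddCommGroup E] [InnerProductSpace ℂ E] [CompleteSpace E]
  {A A' T : E →ₗ.[ℂ] E} {c z : ℂ} {P J : E →L[ℂ] E}

theorem rho_eq_of_swap (hA : IsShiftedInverse A c (P * J)) (hA' : IsShiftedInverse A' c (J * P)) :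
    rho A = rho A' := by
  ext z
  rw [hA.mem_rho_iff, hA'.mem_rho_iff]
  constructor
  · intro h
    rw [← mul_smul_comm]
    exact isUnit_one_sub_mul_swap (by rwa [smul_mul_assoc])
  · intro h
    rw [← smul_mul_assoc]
    exact isUnit_one_sub_mul_swap (by rwa [mul_smul_comm])

/-- If `A + c = (P J)⁻¹`, `A' + c = (J P)⁻¹` and `T = J⁻¹`, then the resolvents of `A` and `A'`
are conjugate under `T`. -/
theorem resolventOp_eq_of_swap (hA : IsShiftedInverse A c (P * J))
    (hA' : IsShiftedInverse A' c (J * P)) (hT : IsShiftedInverse T 0 J) (hz : z ∈ rho A) :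
    resolventOp A z = prodOp T (prodOp (resolventOp A' z) T.inverse) := by
  have hz' := hz
  rw [rho_eq_of_swap hA hA'] at hz'
  obtain ⟨u, hu⟩ := hA.mem_rho_iff.1 hz
  obtain ⟨u', hu'⟩ := hA'.mem_rho_iff.1 hz'
  have hr := fun x y => hA.mem_graph_resolventOp (x := x) (y := y)
    (by rw [← hu]; exact u.inv_mul) (by rw [← hu]; exact u.mul_inv)
  have hr' := fun x y => hA'.mem_graph_resolventOp (x := x) (y := y)
    (by rw [← hu']; exact u'.inv_mul) (by rw [← hu']; exact u'.mul_inv)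
  have hcomm : (↑u'⁻¹ : E →L[ℂ] E) * J = J * (↑u⁻¹ : E →L[ℂ] E) := by
    rw [Units.inv_mul_eq_iff_eq_mul, ← mul_assoc, Units.eq_mul_inv_iff_mul_eq, hu, hu']
    simp only [sub_mul, mul_sub, one_mul, mul_one, smul_mul_assoc, mul_smul_comm, mul_assoc]
  refine linearPMap_ext_graph fun x y => ?_
  simp only [mem_graph_prodOp, hT.mem_graph_inverse, hr, hr', isShiftedInverse_zero.1 hT]
  have key : (J * P) ((↑u'⁻¹ : E →L[ℂ] E) (J x)) = J ((P * J) ((↑u⁻¹ : E →L[ℂ] E) x)) := by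
    have := DFunLike.congr_fun hcomm x
    simp only [mul_apply_eq_comp] at this ⊢
    rw [this]
  constructor
  · rintro rfl
    exact ⟨_, ⟨_, rfl, rfl⟩, key⟩
  · rintro ⟨_, ⟨_, rfl, rfl⟩, h⟩
    exact hT.injective (h.symm.trans key)

theorem sigma_subset_real {A : E →ₗ.[ℂ] E} {t : ℝ} {K : E →L[ℂ] E}
    (hA : IsShiftedInverse A (t : ℂ) K) (hK : IsSelfAdjoint K) : sigma A ⊆ {z | z.im = 0} := by
  intro z hz
  by_contra hz0
  refine hz (hA.mem_rho_iff.2 ?_)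
  have him : (z + t).im ≠ 0 := by simpa using hz0
  have hne : z + (t : ℂ) ≠ 0 := fun h => him (by rw [h]; rfl)
  have hnot : (z + (t : ℂ))⁻¹ ∉ spectrum ℂ K := by
    intro hmem
    have h1 := congrArg Complex.im (hK.mem_spectrum_eq_re hmem)
    rw [Complex.inv_im, Complex.ofReal_im, div_eq_zero_iff] at h1
    rcases h1 with h1 | h1
    · exact him (neg_eq_zero.1 h1)
    · exact hne (Complex.normSq_eq_zero.1 h1)
  rw [spectrum.notMem_iff] at hnot
  have h2 := (IsUnit.mk0 _ hne).map (algebraMap ℂ (E →L[ℂ] E)) |>.mul hnot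
  rw [mul_sub, ← map_mul, mul_inv_cancel₀ hne, map_one, ← Algebra.smul_def] at h2
  exact h2

end Swap

/-! ### Products of two operators that differ by a bounded operator -/

section Products

variable {E : Type*} [NormedAddCommGroup E] [InnerProductSpace ℂ E]
  {D D' T : E →ₗ.[ℂ] E} {t : ℂ} {G J R : E →L[ℂ] E}

theorem mem_graph_iff_of_isShiftedInverse_add
    (hG : IsShiftedInverse (D' + (t • R : E →L[ℂ] E).toPMap ⊤) 0 G) {x y : E} :
    (x, y) ∈ D'.graph ↔ x = G (y + t • R x) := by
  rw [← isShiftedInverse_zero.1 hG, mem_graph_add_toPMap_top]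
  simp

/-- The operator `D D' + t` equals `D (D' + t D⁻¹)`. -/
theorem isShiftedInverse_prodOp (hR : IsShiftedInverse D 0 R)
    (hG : IsShiftedInverse (D' + (t • R : E →L[ℂ] E).toPMap ⊤) 0 G) :
    IsShiftedInverse (prodOp D D') t (G * R) := by
  intro x y
  simp only [mem_graph_prodOp, isShiftedInverse_zero.1 hR, mem_graph_iff_of_isShiftedInverse_add hG,
    mul_apply_eq_comp, map_add, map_smul]
  exact ⟨fun ⟨w, h, hw⟩ => hw ▸ h, fun h => ⟨_, h, rfl⟩⟩

/-- The operator `T D' T + t` equals `T (D' + t T⁻²) T`. -/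
theorem isShiftedInverse_prodOp_prodOp (hT : IsShiftedInverse T 0 J) (hJJ : ∀ x, J (J x) = R x)
    (hG : IsShiftedInverse (D' + (t • R : E →L[ℂ] E).toPMap ⊤) 0 G) :
    IsShiftedInverse (prodOp T (prodOp D' T)) t (J * G * J) := by
  intro x y
  simp only [mem_graph_prodOp, isShiftedInverse_zero.1 hT, mem_graph_iff_of_isShiftedInverse_add hG,
    mul_apply_eq_comp]
  constructor
  · rintro ⟨v, ⟨w, h1, h2⟩, h3⟩
    rw [h3, ← hJJ, ← h1, ← map_smul, ← map_add] at h2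
    rw [← h2]; exact h1
  · intro h
    refine ⟨J y, ⟨G (J (y + t • x)), h, ?_⟩, rfl⟩
    rw [← hJJ, ← h, ← map_smul, ← map_add]

end Products

/-! ### The domain of `Λ` -/

section DomLambda

variable {E : Type*} [NormedAddCommGroup E] [InnerProductSpace ℂ E] [CompleteSpace E]

theorem isClosed_kerOp {A : E →ₗ.[ℂ] E} (hA : IsSelfAdjoint A) :
    IsClosed (kerOp A : Set E) := by
  have hg : IsClosed (A.graph : Set (E × E)) := IsSelfAdjoint.isClosed hA
  have : (kerOp A : Set E) = (fun x => (x, (0 : E))) ⁻¹' (A.graph : Set (E × E)) := by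
    ext x
    exact mem_kerOp
  rw [this]
  exact hg.preimage (by fun_prop)

theorem exists_kerProj_eq {A : E →ₗ.[ℂ] E} (hA : IsSelfAdjoint A) :
    ∃ P : E →L[ℂ] E, kerProj A = (P : E →ₗ[ℂ] E).toPMap ⊤ ∧
      (∀ x, (P x, (0 : E)) ∈ A.graph) ∧ ∀ x, (x, (0 : E)) ∈ A.graph → P x = x := by
  have hcl : (kerOp A).topologicalClosure = kerOp A :=
    (isClosed_kerOp hA).submodule_topologicalClosure_eq
  refine ⟨(kerOp A).topologicalClosure.starProjection, rfl, fun x => ?_, fun x hx => ?_⟩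
  · have := Submodule.starProjection_apply_mem (kerOp A).topologicalClosure x
    rw [← mem_kerOp]
    exact hcl.le this
  · rw [Submodule.starProjection_eq_self_iff]
    exact hcl.ge (mem_kerOp.2 hx)

/-- Since the range of `A` is orthogonal to its kernel, `A + P₀` is injective. -/
theorem eq_zero_of_mem_graph_add_kerProj {A : E →ₗ.[ℂ] E} (hA : IsSelfAdjoint A) {x : E}
    (hx : (x, (0 : E)) ∈ (A + kerProj A).graph) : x = 0 := by
  obtain ⟨P, hP, hPker, hPfix⟩ := exists_kerProj_eq hA
  rw [hP, mem_graph_add_toPMap_top, zero_sub] at hx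
  have h0 := (mem_graph_iff_of_isSelfAdjoint hA).1 (hPker x) _ _ hx
  rw [inner_neg_right, inner_zero_left, neg_eq_zero] at h0
  have hPx : P x = 0 := inner_self_eq_zero.1 h0
  rw [ContinuousLinearMap.coe_coe, hPx, neg_zero] at hx
  rw [← hPfix x hx, hPx]

/-- The range defining `dom Λ` is the natural domain of the product `D₂^{1/2} D₁ D₂^{1/2}`: the
projection `P₀` takes values in `ker D₁`, which is contained in `dom D₂^{1/2}`. -/
theorem domLambda_eq {D₁ D₂ : L2 →ₗ.[ℂ] L2} (hD₁ : IsSelfAdjoint D₁) {J : L2 →L[ℂ] L2}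
    (hT : IsShiftedInverse (posSqrt D₂) 0 J)
    (hker : ∀ x, (x, (0 : L2)) ∈ D₁.graph → x ∈ (posSqrt D₂).domain) :
    domLambda D₁ D₂ = (prodOp (posSqrt D₂) (prodOp D₁ (posSqrt D₂))).domain := by
  have hT' := isShiftedInverse_zero.1 hT
  obtain ⟨P, hP, hPker, -⟩ := exists_kerProj_eq hD₁
  have hPJ : ∀ x, ∃ y, P x = J y := fun x => by
    obtain ⟨y, hy⟩ := mem_domain_iff_exists_graph.1 (hker _ (hPker x))
    exact ⟨y, (hT' _ _).1 hy⟩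
  have hinv : ∀ a b, (a, b) ∈ (D₁ + kerProj D₁).inverse.graph ↔ (b, a - P b) ∈ D₁.graph := by
    intro a b
    rw [mem_graph_inverse fun x hx => eq_zero_of_mem_graph_add_kerProj hD₁ hx, hP,
      mem_graph_add_toPMap_top]
    rfl
  ext f
  rw [domLambda, mem_ranOp, mem_domain_iff_exists_graph]
  simp only [mem_graph_prodOp, hT.mem_graph_inverse, hinv, hT']
  constructor
  · rintro ⟨g, b, ⟨_, rfl, h⟩, rfl⟩
    obtain ⟨y, hy⟩ := hPJ b
    exact ⟨g - y, J g - P b, ⟨b, rfl, h⟩, by rw [map_sub, hy]⟩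
  · rintro ⟨y, v, ⟨b, rfl, h⟩, rfl⟩
    obtain ⟨g, hg⟩ := hPJ b
    exact ⟨y + g, b, ⟨_, rfl, by rw [map_add, hg]; simpa using h⟩, rfl⟩

theorem opLambda_eq {D₁ D₂ : L2 →ₗ.[ℂ] L2}
    (h : domLambda D₁ D₂ = (prodOp (posSqrt D₂) (prodOp D₁ (posSqrt D₂))).domain) :
    opLambda D₁ D₂ = prodOp (posSqrt D₂) (prodOp D₁ (posSqrt D₂)) := by
  refine LinearPMap.eq_of_le_of_domain_eq LinearPMap.domRestrict_le ?_
  rw [opLambda, LinearPMap.domRestrict_domain, h, inf_idem]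

end DomLambda

/-! ### Multiplication operators on `L²(ℝ)` -/

section Multiplication

/-- Multiplication by an essentially bounded function on `L²(ℝ)`. -/
noncomputable def mulCLM (g : Lp ℂ ∞ (volume : Measure ℝ)) : L2 →L[ℂ] L2 :=
  LinearMap.mkContinuous
    { toFun := fun f => (g • f : L2)
      map_add' := fun f f' => Lp.add_smul g f f'
      map_smul' := fun c f => (Lp.smul_comm c g f).symm } ‖g‖ fun f => Lp.norm_smul_le g f

theorem mulCLM_apply (g : Lp ℂ ∞ (volume : Measure ℝ)) (f : L2) : mulCLM g f = g • f := rfl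

theorem coeFn_mulCLM {V : ℝ → ℝ} (hV : MemLp (fun x => (V x : ℂ)) ∞ (volume : Measure ℝ))
    (f : L2) : ∀ᵐ x, mulCLM hV.toLp f x = (V x : ℂ) * f x := by
  rw [mulCLM_apply]
  filter_upwards [Lp.coeFn_lpSMul (r := 2) hV.toLp f, hV.coeFn_toLp] with x h1 h2
  rw [h1, Pi.smul_apply', h2, smul_eq_mul]

theorem isSelfAdjoint_mulCLM {V : ℝ → ℝ}
    (hV : MemLp (fun x => (V x : ℂ)) ∞ (volume : Measure ℝ)) :
    IsSelfAdjoint (mulCLM hV.toLp) := by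
  rw [ContinuousLinearMap.isSelfAdjoint_iff_isSymmetric]
  intro f g
  rw [L2.inner_def, L2.inner_def]
  refine integral_congr_ae ?_
  filter_upwards [coeFn_mulCLM hV f, coeFn_mulCLM hV g] with x h1 h2
  simp only [ContinuousLinearMap.coe_coe, h1, h2, RCLike.inner_apply, map_mul, Complex.conj_ofReal]
  ring

theorem mulOp_eq {V : ℝ → ℝ} (hV : MemLp (fun x => (V x : ℂ)) ∞ (volume : Measure ℝ)) :
    mulOp V = (mulCLM hV.toLp : L2 →ₗ[ℂ] L2).toPMap ⊤ := by
  refine linearPMap_ext_graph fun x y => ?_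
  rw [mulOp, Submodule.toLinearPMap_graph_eq _ fun p hp h => mulGraph_snd V hp h,
    mem_graph_toPMap_top]
  constructor
  · intro h
    have h' : ∀ᵐ t, y t = (V t : ℂ) * x t := h
    refine Lp.ext ?_
    filter_upwards [h', coeFn_mulCLM hV x] with t h1 h2
    rw [h1, ContinuousLinearMap.coe_coe, h2]
  · rintro rfl
    exact coeFn_mulCLM hV x

/-- A `C¹` function with integrable derivative is bounded. -/
theorem IsAdmissible.memLp_top {q : ℝ → ℝ} (hq : IsAdmissible q) (h : ℝ) :
    MemLp (fun x => ((q x + h : ℝ) : ℂ)) ∞ (volume : Measure ℝ) := by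
  have hcont : Continuous (deriv q) := hq.contDiff.continuous_deriv le_rfl
  have hint : Integrable (deriv q) := by
    refine (hq.integrable 1 (by norm_num)).mono hcont.aestronglyMeasurable ?_
    filter_upwards with x
    rw [iteratedDeriv_one, norm_mul, Real.norm_eq_abs (|_|), abs_abs, ← Real.norm_eq_abs]
    refine le_mul_of_one_le_left (norm_nonneg _) ?_
    rw [Real.norm_of_nonneg (by positivity)]
    exact le_add_of_nonneg_right (by positivity)
  have hb : ∀ x, ‖((q x + h : ℝ) : ℂ)‖ ≤ |q 0| + (∫ y, ‖deriv q y‖) + |h| := by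
    intro x
    have h1 : ∫ y in (0 : ℝ)..x, deriv q y = q x - q 0 :=
      intervalIntegral.integral_deriv_eq_sub
        (fun y _ => (hq.contDiff.differentiable one_ne_zero) y) (hcont.intervalIntegrable _ _)
    have h2 : |q x - q 0| ≤ ∫ y, ‖deriv q y‖ := by
      rw [← h1, ← Real.norm_eq_abs]
      refine intervalIntegral.norm_integral_le_integral_norm_uIoc.trans ?_
      exact setIntegral_le_integral hint.norm (Filter.Eventually.of_forall fun y => norm_nonneg _)
    rw [Complex.norm_real, Real.norm_eq_abs]
    have h3 : q x + h = q 0 + (q x - q 0) + h := by ring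
    rw [h3]
    refine (abs_add_le _ _).trans (add_le_add ((abs_add_le _ _).trans ?_) le_rfl)
    exact add_le_add le_rfl h2
  refine memLp_top_of_bound ?_ _ (Filter.Eventually.of_forall hb)
  exact (Complex.continuous_ofReal.comp
    (hq.contDiff.continuous.add continuous_const)).aestronglyMeasurable

end Multiplication

/-! ### The second derivative on `H²(ℝ)` -/

section SecondDeriv

open Real FourierTransform

/-- In dimension one the Bessel potential of order two is `1 - (2π)⁻² ∂²`. -/
theorem besselPotential_two_eq (u : 𝓢'(ℝ, ℂ)) :
    besselPotential ℝ ℂ 2 u =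
      u - ((((2 * π) ^ 2 : ℝ) : ℂ)⁻¹) • ∂_{(1 : ℝ)} (∂_{(1 : ℝ)} u) := by
  have hg : (fun x : ℝ => ((x ^ 2 : ℝ) : ℂ)).HasTemperateGrowth := by fun_prop
  have hb : besselPotential ℝ ℂ 2 u =
      u + fourierMultiplierCLM ℂ (fun x : ℝ => ((x ^ 2 : ℝ) : ℂ)) u := by
    have h1 : (fun x : ℝ => (((1 + ‖x‖ ^ 2) ^ ((2 : ℝ) / 2) : ℝ) : ℂ)) =
        (fun _ : ℝ => (1 : ℂ)) + fun x : ℝ => ((x ^ 2 : ℝ) : ℂ) := by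
      ext x
      simp
    have h2 : (fun _ : ℝ => (1 : ℂ)).HasTemperateGrowth := by fun_prop
    rw [besselPotential, h1, fourierMultiplierCLM_apply, fourierMultiplierCLM_apply,
      smulLeftCLM_add h2 hg, add_apply, smulLeftCLM_const, one_smul, FourierTransform.fourierInv_add,
      fourierInv_fourier_eq]
  have hd : ∂_{(1 : ℝ)} (∂_{(1 : ℝ)} u) =
      (-(((2 * π) ^ 2 : ℝ) : ℂ)) • fourierMultiplierCLM ℂ (fun x : ℝ => ((x ^ 2 : ℝ) : ℂ)) u := by
    simp_rw [TemperedDistribution.lineDeriv_eq_fourierMultiplierCLM, map_smul, smul_smul]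
    rw [fourierMultiplierCLM_fourierMultiplierCLM_apply (by fun_prop) (by fun_prop)]
    congr 1
    · push_cast
      linear_combination (2 * (π : ℂ)) ^ 2 * Complex.I_sq
    · congr 1
      simp [sq, Pi.mul_def]
  have hne : (((2 * π) ^ 2 : ℝ) : ℂ) ≠ 0 := by
    rw [Complex.ofReal_ne_zero]; positivity
  rw [hb, hd, smul_smul, mul_neg, inv_mul_cancel₀ hne, neg_smul, one_smul, sub_neg_eq_add]

/-- On `L²(ℝ)` the inverse of the Bessel potential of order two is a bounded selfadjoint operator:
by Plancherel's theorem it is unitarily equivalent to multiplication by `(1 + ξ²)⁻¹`. -/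
theorem exists_besselPotential_inverse : ∃ K : L2 →L[ℂ] L2, IsSelfAdjoint K ∧
    ∀ f : L2, besselPotential ℝ ℂ 2 (K f : 𝓢'(ℝ, ℂ)) = (f : 𝓢'(ℝ, ℂ)) := by
  have hg : (fun x : ℝ => (((1 + ‖x‖ ^ 2) ^ ((-2 : ℝ) / 2) : ℝ) : ℂ)).HasTemperateGrowth := by
    fun_prop
  have hm : MemLp (fun x : ℝ => (((1 + ‖x‖ ^ 2) ^ ((-2 : ℝ) / 2) : ℝ) : ℂ)) ∞
      (volume : Measure ℝ) := by
    refine memLp_top_of_bound hg.1.continuous.aestronglyMeasurable 1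
      (Filter.Eventually.of_forall fun x => ?_)
    rw [Complex.norm_real, Real.norm_of_nonneg (by positivity)]
    exact Real.rpow_le_one_of_one_le_of_nonpos (by simp [sq_nonneg]) (by norm_num)
  let Φ := Lp.fourierTransformₗᵢ ℝ ℂ
  let K : L2 →L[ℂ] L2 := (Φ.symm : L2 →L[ℂ] L2) ∘L mulCLM hm.toLp ∘L (Φ : L2 →L[ℂ] L2)
  have hK : ∀ f, K f = 𝓕⁻ (mulCLM hm.toLp (𝓕 f)) := fun f => rfl
  refine ⟨K, ?_, fun f => ?_⟩
  · rw [ContinuousLinearMap.isSelfAdjoint_iff_isSymmetric]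
    intro f g
    have hs : ∀ a b, inner ℂ (mulCLM hm.toLp a) b = inner ℂ a (mulCLM hm.toLp b) :=
      (isSelfAdjoint_mulCLM hm).isSymmetric
    rw [ContinuousLinearMap.coe_coe, hK, hK, ← Lp.inner_fourier_eq, ← Lp.inner_fourier_eq f,
      fourier_fourierInv_eq, fourier_fourierInv_eq, hs]
  · rw [← besselPotential_neg_apply_eq_iff, hK, ← Lp.fourierInv_toTemperedDistribution_eq,
      mulCLM_apply, Lp.toTemperedDistribution_smul_eq hg, ← Lp.fourier_toTemperedDistribution_eq]
    rfl

theorem L2.toTemperedDistribution_injective :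
    Function.Injective (fun f : L2 => (f : 𝓢'(ℝ, ℂ))) :=
  LinearMap.ker_eq_bot.1 (Lp.ker_toTemperedDistributionCLM_eq_bot (F := ℂ)
    (μ := (volume : Measure ℝ)) (p := 2))

/-- The operator `-u'' + (2π)² u` is `(2π)²` times the Bessel potential of order two. -/
theorem isSelfAdjoint_neg_secondDeriv : IsSelfAdjoint (-secondDeriv) := by
  obtain ⟨K, hK, hKf⟩ := exists_besselPotential_inverse
  set a : ℝ := (2 * π) ^ 2 with ha
  have hne : (a : ℂ) ≠ 0 := by
    rw [Complex.ofReal_ne_zero, ha]; positivity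
  have hinj : ∀ u v : 𝓢'(ℝ, ℂ), besselPotential ℝ ℂ 2 u = besselPotential ℝ ℂ 2 v → u = v := by
    intro u v h
    rw [← (besselPotential_neg_apply_eq_iff 2 _ u).2 rfl, h,
      (besselPotential_neg_apply_eq_iff 2 _ v).2 rfl]
  have hmap : ∀ (f g : L2) (c : ℂ), ((f + c • g : L2) : 𝓢'(ℝ, ℂ)) =
      (f : 𝓢'(ℝ, ℂ)) + c • (g : 𝓢'(ℝ, ℂ)) := fun f g c => by
    have h := (Lp.toTemperedDistributionCLM ℂ (volume : Measure ℝ) 2).map_add f (c • g)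
    rw [map_smul] at h
    exact h
  have hsh : IsShiftedInverse (-secondDeriv) (a : ℂ) ((a : ℂ)⁻¹ • K) := by
    intro x y
    rw [mem_graph_neg, secondDeriv,
      Submodule.toLinearPMap_graph_eq _ fun p hp h => secondDerivGraph_snd hp h]
    have hx : x = ((a : ℂ)⁻¹ • K) (y + (a : ℂ) • x) ↔ x = K (x + (a : ℂ)⁻¹ • y) := by
      rw [smul_apply, ← map_smul, smul_add, inv_smul_smul₀ hne, add_comm]
    have hx' : x = K (x + (a : ℂ)⁻¹ • y) ↔
        besselPotential ℝ ℂ 2 (x : 𝓢'(ℝ, ℂ)) =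
          (x : 𝓢'(ℝ, ℂ)) + (a : ℂ)⁻¹ • (y : 𝓢'(ℝ, ℂ)) := by
      rw [← hmap, ← hKf (x + (a : ℂ)⁻¹ • y)]
      exact ⟨fun h => by rw [← h], fun h => L2.toTemperedDistribution_injective (hinj _ _ h)⟩
    have hn : ((-y : L2) : 𝓢'(ℝ, ℂ)) = -(y : 𝓢'(ℝ, ℂ)) :=
      (Lp.toTemperedDistributionCLM ℂ (volume : Measure ℝ) 2).map_neg y
    rw [hx, hx']
    constructor
    · rintro ⟨-, h⟩
      rw [besselPotential_two_eq, ← ha, h, hn, smul_neg, sub_neg_eq_add]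
    · intro h
      refine ⟨⟨x + (a : ℂ)⁻¹ • y, by rw [hmap]; exact h⟩, ?_⟩
      rw [besselPotential_two_eq, ← ha, sub_eq_add_neg, add_right_inj, neg_eq_iff_eq_neg] at h
      change _ = ((-y : L2) : 𝓢'(ℝ, ℂ))
      rw [hn]
      refine smul_right_injective _ (inv_ne_zero hne) (h.trans ?_)
      exact (smul_neg _ _).symm
  refine hsh.isSelfAdjoint ?_
  refine IsSelfAdjoint.smul ?_ hK
  rw [← Complex.ofReal_inv]
  exact Complex.conj_ofReal _

end SecondDeriv

end SpecOp

theorem mainTheorem3 (h₁ h₂ : ℝ) (hh₁ : 0 < h₁) (hh₂ : h₁ < h₂) (q₁ q₂ : ℝ → ℝ)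
    (hq₁ : IsAdmissible q₁) (hq₂ : IsAdmissible q₂)
    (D₁ D₂ L Λ : L2 →ₗ.[ℂ] L2)
    (hD₁ : D₁ = schrodinger h₁ q₁) (hD₂ : D₂ = schrodinger h₂ q₂)
    (hpos : ∃ c₂ : ℝ, 0 < c₂ ∧
      ∀ u : D₂.domain, c₂ * ‖(u : L2)‖ ^ 2 ≤ (inner ℂ (u : L2) (D₂ u)).re)
    (hL : L = opL D₁ D₂) (hΛ : Λ = opLambda D₁ D₂) :
    -- the objects are well defined
    IsPosSqrt (posSqrt D₂) D₂ ∧ Dense (L.domain : Set L2) ∧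
    Λ.domain = domLambda D₁ D₂ ∧ IsSelfAdjoint Λ ∧
    -- the resolvent sets coincide
    rho L = rho L.adjoint ∧ rho L.adjoint = rho Λ ∧
    -- the resolvents are related, as operators defined on all of `L²(ℝ)`
    (∀ z ∈ rho L,
      resolventOp L z =
        prodOp (posSqrt D₂) (prodOp (resolventOp Λ z) (posSqrt D₂).inverse) ∧
      resolventOp Λ z =
        prodOp (posSqrt D₂) (prodOp (resolventOp L.adjoint z) (posSqrt D₂).inverse)) ∧
    -- the spectra are real
    sigma L ⊆ {z | z.im = 0} ∧ sigma L.adjoint ⊆ {z | z.im = 0} ∧ sigma Λ ⊆ {z | z.im = 0} := by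
  set B₁ : L2 →L[ℂ] L2 := mulCLM (hq₁.memLp_top h₁).toLp
  set B₂ : L2 →L[ℂ] L2 := mulCLM (hq₂.memLp_top h₂).toLp
  have hB₁s : IsSelfAdjoint B₁ := isSelfAdjoint_mulCLM _
  have hB₂s : IsSelfAdjoint B₂ := isSelfAdjoint_mulCLM _
  have hD₁' : D₁ = -secondDeriv + (B₁ : L2 →ₗ[ℂ] L2).toPMap ⊤ := by
    rw [hD₁, schrodinger, mulOp_eq (hq₁.memLp_top h₁)]
  have hD₂' : D₂ = -secondDeriv + (B₂ : L2 →ₗ[ℂ] L2).toPMap ⊤ := by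
    rw [hD₂, schrodinger, mulOp_eq (hq₂.memLp_top h₂)]
  have hD₁s : IsSelfAdjoint D₁ :=
    hD₁' ▸ isSelfAdjoint_add_toPMap_top isSelfAdjoint_neg_secondDeriv hB₁s
  have hD₂s : IsSelfAdjoint D₂ :=
    hD₂' ▸ isSelfAdjoint_add_toPMap_top isSelfAdjoint_neg_secondDeriv hB₂s
  have hDB : D₁ = D₂ + ((B₁ - B₂ : L2 →L[ℂ] L2) : L2 →ₗ[ℂ] L2).toPMap ⊤ := by
    refine linearPMap_ext_graph fun x y => ?_
    rw [hD₁', hD₂', mem_graph_add_toPMap_top, mem_graph_add_toPMap_top, mem_graph_add_toPMap_top]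
    have hxy : y - ((B₁ - B₂ : L2 →L[ℂ] L2) : L2 →ₗ[ℂ] L2) x - (B₂ : L2 →ₗ[ℂ] L2) x =
        y - (B₁ : L2 →ₗ[ℂ] L2) x := by
      change y - (B₁ x - B₂ x) - B₂ x = y - B₁ x
      abel
    rw [hxy]
  obtain ⟨c₂, hc₂, hcoer⟩ := hpos
  have hcoer' : ∀ x y, (x, y) ∈ D₂.graph → c₂ * ‖x‖ ^ 2 ≤ (inner ℂ x y).re := by
    intro x y hxy
    obtain ⟨h, rfl⟩ := mem_graph_iff_exists_mem.1 hxy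
    exact hcoer ⟨x, h⟩
  -- `R = D₂⁻¹`, `J = D₂^{-1/2}` and `G = (D₁ + t R)⁻¹`, all bounded and selfadjoint.
  obtain ⟨R, hRs, hR⟩ := exists_bounded_inverse_of_coercive hD₂s hc₂ hcoer'
  replace hR := isShiftedInverse_zero.2 hR
  have hsqrt : IsPosSqrt (posSqrt D₂) D₂ := isPosSqrt_posSqrt <| exists_isPosSqrt hRs hR
    fun x y hxy => (by positivity : 0 ≤ c₂ * ‖x‖ ^ 2).trans (hcoer' x y hxy)
  obtain ⟨J, hJs, hJ, hJJ⟩ := hsqrt.exists_bounded_inverse hR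
  obtain ⟨t, G, hGs, hG⟩ :=
    exists_bounded_inverse_add_smul hD₂s (hB₁s.sub hB₂s) hJs hRs hJJ hR
  rw [← hDB] at hG
  have hRJ : R = J * J := ContinuousLinearMap.ext fun x => (hJJ x).symm
  -- `ker D₁ ⊆ dom D₂ ⊆ dom D₂^{1/2}`, as `D₁` and `D₂` have the same domain.
  have hdom := domLambda_eq hD₁s hJ fun x hx => by
    rw [hDB, mem_graph_add_toPMap_top, ← hsqrt.prodOp_self, mem_graph_prodOp] at hx
    obtain ⟨w, hw, -⟩ := hx
    exact mem_domain_iff_exists_graph.2 ⟨w, hw⟩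
  have hΛ' : Λ = prodOp (posSqrt D₂) (prodOp D₁ (posSqrt D₂)) := hΛ.trans (opLambda_eq hdom)
  have hΛi : IsShiftedInverse Λ (t : ℂ) (J * G * J) :=
    hΛ' ▸ isShiftedInverse_prodOp_prodOp hJ hJJ hG
  have hLi : IsShiftedInverse L (t : ℂ) (G * R) := hL ▸ isShiftedInverse_prodOp hR hG
  have hadj : ContinuousLinearMap.adjoint (G * R) = R * G := by
    rw [← ContinuousLinearMap.star_eq_adjoint, star_mul, hGs.star_eq, hRs.star_eq]
  have hadjinj : Function.Injective (ContinuousLinearMap.adjoint (G * R)) := by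
    rw [hadj]
    exact hR.injective.comp hG.injective
  have hLai := hLi.adjoint hadjinj
  rw [hadj, Complex.conj_ofReal] at hLai
  rw [hRJ, ← mul_assoc] at hLi
  rw [hRJ, mul_assoc] at hLai
  have hΛi' := hΛi
  rw [mul_assoc] at hΛi'
  have hρ : rho L = rho Λ := rho_eq_of_swap hLi hΛi'
  have hρ' : rho Λ = rho L.adjoint := rho_eq_of_swap hΛi hLai
  have hKs : IsSelfAdjoint (J * G * J) := by
    rw [isSelfAdjoint_iff, star_mul, star_mul, hJs.star_eq, hGs.star_eq, mul_assoc]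
  have hσ : sigma Λ ⊆ {z | z.im = 0} := sigma_subset_real hΛi hKs
  refine ⟨hsqrt, ?_, ?_, hΛi.isSelfAdjoint hKs, hρ.trans hρ', hρ'.symm, fun z hz => ⟨?_, ?_⟩,
    ?_, ?_, hσ⟩
  · rw [hRJ, ← mul_assoc] at hadjinj
    exact hLi.dense_domain hadjinj
  · rw [hΛ', hdom]
  · exact resolventOp_eq_of_swap hLi hΛi' hJ hz
  · exact resolventOp_eq_of_swap hΛi hLai hJ (hρ ▸ hz)
  · rw [sigma, hρ]; exact hσ
  · rw [sigma, ← hρ']; exact hσ
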